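/- A set $X$ is dually Dedekind finite if every surjection from $X$ onto $X$ is injective. Consider the universe of sets (in the sense of $\mathsf{ZFA}$) over the following set of atoms. Let $A=\bigcup_{n\in\omega}A_n$ with pairwise distinct atoms, where $$A_n=\{[s]_n\mid s\text{ is a nonempty finite string of numbers }0,\dots,n\},$$ and for $i\leqslant n$ let $A_{n,i}=\{[i^\frown s]_n\mid s\text{ is a finite string of numbers }0,\dots,n\}$. For each $n\in\omega$ define $f_n:\prod_{i\leqslant n}A_{n,i}\to\{\varnothing\}\cup\prod_{i\leqslant n}A_{n,i}$ by $$f_n([0j_0]_n,\dots,[nj_n]_n)=\varnothing,$$ $$f_n([0^\frown s_0{}^\frown k_0l_0]_n,\dots,[n^\frown s_n{}^\frown k_nl_n]_n)=([0^\frown s_0{}^\frown m_0]_n,\dots,[n^\frown s_n{}^\frown m_n]_n)$$ whenever $s_0,\dots,s_n$ are finite strings (possibly empty) of the same length, where $m_i\in\{0,\dots,n\}$ and $m_i\equiv\sum_{j\neq i}k_j\pmod{n+1}$ for every $i\leqslant n$, and $f_n(x)=x$ for all other $x$. Every permutation $\pi$ of $A$ extends recursively to the universe by $\pi x=\{\pi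 z\mid z\in x\}$ for sets $x$. Let $\mathcal{G}$ be the group of all permutations $\pi$ of $A$ such that for every $n\in\omega$: (1) $\pi$ fixes $A_{n,i}$ setwise for all $i\leqslant n$; (2) whenever $\pi[s]_n=[t]_n$, the strings $s$ and $t$ have the same length; (3) $\pi f_n=f_n$. Let $\mathcal{V}$ be the permutation model determined by $\mathcal{G}$ and finite supports: $x\in\mathcal{V}$ if and only if all elements of $x$ belong to $\mathcal{V}$ and there is a finite set $E\subseteq A$ such that every $\pi\in\mathcal{G}$ fixing $E$ pointwise satisfies $\pi x=x$. Lemma. In $\mathcal{V}$, for every $n\in\omega$ and all $e_0,\dots,e_n\in\omega$, if at least one of $e_0,\dots,e_n$ is zero, then the product $\prod_{i\leqslant n}A_{n,i}^{e_i}$ (which exists in $\mathcal{V}$) is dually Dedekind finite. -/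

import Mathlib

universe u v

/-! ## The universe of sets over a type of atoms -/

/-- Pre-sets over a type `A` of atoms: a pre-set is either an atom or a family of pre-sets
indexed by a type in `Type u`. -/
inductive PreZFA (A : Type v) : Type (max v (u + 1))
  | atom (a : A) : PreZFA A
  | mk (ι : Type u) (f : ι → PreZFA A) : PreZFA A

namespace PreZFA

/-- Extensional equality of pre-sets. An atom is equal only to itself; in particular
it is different from every set, also from the empty one. -/
def Equiv {A : Type v} : PreZFA.{u, v} A → PreZFA.{u, v} A → Prop
  | atom a, atom b => a = b
  | mk _ f, mk _ g => (∀ i, ∃ j, Equiv (f i) (g j)) ∧ (∀ j, ∃ i, Equiv (f i) (g j))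
  | _, _ => False

theorem Equiv.refl {A : Type v} : ∀ x : PreZFA.{u, v} A, Equiv x x
  | atom _ => by simp only [Equiv]
  | mk _ f => by
    simp only [Equiv]
    exact ⟨fun i => ⟨i, Equiv.refl (f i)⟩, fun i => ⟨i, Equiv.refl (f i)⟩⟩

theorem Equiv.symm {A : Type v} : ∀ {x y : PreZFA.{u, v} A}, Equiv x y → Equiv y x
  | atom _, atom _, h => by
    simp only [Equiv] at h ⊢
    exact h.symm
  | mk _ f, mk _ g, h => by
    simp only [Equiv] at h ⊢
    exact ⟨fun j => (h.2 j).imp fun _ hi => Equiv.symm hi,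
      fun i => (h.1 i).imp fun _ hj => Equiv.symm hj⟩
  | atom _, mk _ _, h => by simp only [Equiv] at h
  | mk _ _, atom _, h => by simp only [Equiv] at h

theorem Equiv.trans {A : Type v} :
    ∀ {x y z : PreZFA.{u, v} A}, Equiv x y → Equiv y z → Equiv x z
  | atom _, atom _, atom _, h, k => by
    simp only [Equiv] at h k ⊢
    exact h.trans k
  | mk _ f, mk _ g, mk _ e, h, k => by
    simp only [Equiv] at h k ⊢
    refine ⟨fun i => ?_, fun l => ?_⟩
    · obtain ⟨j, hj⟩ := h.1 i
      obtain ⟨l, hl⟩ := k.1 j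
      exact ⟨l, Equiv.trans hj hl⟩
    · obtain ⟨j, hj⟩ := k.2 l
      obtain ⟨i, hi⟩ := h.2 j
      exact ⟨i, Equiv.trans hi hj⟩
  | atom _, mk _ _, _, h, _ => by simp only [Equiv] at h
  | mk _ _, atom _, _, h, _ => by simp only [Equiv] at h
  | atom _, atom _, mk _ _, _, k => by simp only [Equiv] at k
  | mk _ _, mk _ _, atom _, _, k => by simp only [Equiv] at k

instance setoid (A : Type v) : Setoid (PreZFA.{u, v} A) :=
  ⟨Equiv, Equiv.refl, Equiv.symm, Equiv.trans⟩

/-- Membership of pre-sets; atoms have no elements. -/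
def Mem {A : Type v} (x : PreZFA.{u, v} A) : PreZFA.{u, v} A → Prop
  | atom _ => False
  | mk _ g => ∃ j, Equiv x (g j)

theorem Mem.congr {A : Type v} {x x' y y' : PreZFA.{u, v} A} (hx : Equiv x x')
    (hy : Equiv y y') (h : Mem x y) : Mem x' y' := by
  cases y with
  | atom a => exact h.elim
  | mk ι f =>
    cases y' with
    | atom a => simp only [Equiv] at hy
    | mk κ g =>
      simp only [Equiv] at hy
      obtain ⟨i, hi⟩ := h
      obtain ⟨j, hj⟩ := hy.1 i
      exact ⟨j, (hx.symm.trans hi).trans hj⟩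

/-- Whether a pre-set is an atom. -/
def IsAtom {A : Type v} : PreZFA.{u, v} A → Prop
  | atom _ => True
  | mk _ _ => False

theorem IsAtom.congr {A : Type v} {x y : PreZFA.{u, v} A} (h : Equiv x y)
    (hx : IsAtom x) : IsAtom y := by
  cases x <;> cases y <;> simp_all [Equiv, IsAtom]

/-- The recursive extension of a permutation of the atoms to all pre-sets. -/
def perm {A : Type v} (π : Equiv.Perm A) : PreZFA.{u, v} A → PreZFA.{u, v} A
  | atom a => atom (π a)
  | mk ι f => mk ι fun i => perm π (f i)

theorem perm_congr {A : Type v} (π : Equiv.Perm A) :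
    ∀ {x y : PreZFA.{u, v} A}, Equiv x y → Equiv (perm π x) (perm π y)
  | atom _, atom _, h => by
    simp only [Equiv, perm] at h ⊢
    rw [h]
  | mk _ f, mk _ g, h => by
    simp only [Equiv, perm] at h ⊢
    exact ⟨fun i => (h.1 i).imp fun _ hj => perm_congr π hj,
      fun j => (h.2 j).imp fun _ hi => perm_congr π hi⟩
  | atom _, mk _ _, h => by simp only [Equiv] at h
  | mk _ _, atom _, h => by simp only [Equiv] at h

end PreZFA

/-- The cumulative universe of sets (in the sense of `ZFA`) over the type `A` of atoms. -/
def ZFA (A : Type v) : Type (max v (u + 1)) :=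
  Quotient (PreZFA.setoid.{u, v} A)

namespace ZFA

/-- An atom as an object of the universe. -/
def atom {A : Type v} (a : A) : ZFA.{u, v} A :=
  Quotient.mk _ (PreZFA.atom a)

instance {A : Type v} : Membership (ZFA.{u, v} A) (ZFA.{u, v} A) :=
  ⟨fun y x => Quotient.liftOn₂ x y PreZFA.Mem fun _ _ _ _ hx hy =>
    propext ⟨fun h => h.congr hx hy, fun h => h.congr hx.symm hy.symm⟩⟩

/-- Objects of the universe that are atoms (and not sets). -/
def IsAtom {A : Type v} (x : ZFA.{u, v} A) : Prop :=
  Quotient.liftOn x PreZFA.IsAtom fun _ _ h =>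
    propext ⟨fun k => k.congr h, fun k => k.congr h.symm⟩

/-- The extension of a permutation `π` of the atoms to the universe,
`π x = {π z ∣ z ∈ x}` for sets `x`. -/
def perm {A : Type v} (π : Equiv.Perm A) (x : ZFA.{u, v} A) : ZFA.{u, v} A :=
  Quotient.map (PreZFA.perm π) (fun _ _ h => PreZFA.perm_congr π h) x

/-- The finite set `E` of atoms supports `x` with respect to the group `G`. -/
def Supports {A : Type v} (G : Subgroup (Equiv.Perm A)) (E : Finset A) (x : ZFA.{u, v} A) : Prop :=
  ∀ π ∈ G, (∀ a ∈ E, π a = a) → perm π x = x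

/-- Membership in the permutation model determined by `G` and finite supports: all elements of `x`
are in the model and `x` has a finite support. -/
inductive InModel {A : Type v} (G : Subgroup (Equiv.Perm A)) : ZFA.{u, v} A → Prop
  | intro (x : ZFA.{u, v} A) (hmem : ∀ y ∈ x, InModel G y) (hsupp : ∃ E, Supports G E x) :
      InModel G x

end ZFA

/-- The permutation model determined by `G` and finite supports. -/
def PermModel {A : Type v} (G : Subgroup (Equiv.Perm A)) : Type (max v (u + 1)) :=
  {x : ZFA.{u, v} A // ZFA.InModel G x}

/-! ## Set theory inside a permutation model

All quantifiers over `PermModel G` range over the model only. -/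

namespace PermModel

variable {A : Type v} {G : Subgroup (Equiv.Perm A)}

instance : Membership (PermModel.{u, v} G) (PermModel.{u, v} G) :=
  ⟨fun y x => x.1 ∈ y.1⟩

/-- `x` is a set, i.e. not an atom. -/
def IsSet (x : PermModel.{u, v} G) : Prop := ¬ x.1.IsAtom

/-- `z = {x, y}`. -/
def IsUnorderedPair (z x y : PermModel.{u, v} G) : Prop :=
  z.IsSet ∧ ∀ w, w ∈ z ↔ w = x ∨ w = y

/-- `p = (x, y) = {{x}, {x, y}}`. -/
def IsPair (p x y : PermModel.{u, v} G) : Prop :=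
  ∃ a b : PermModel.{u, v} G, a.IsUnorderedPair x x ∧ b.IsUnorderedPair x y ∧ p.IsUnorderedPair a b

/-- `(x, y) ∈ f`. -/
def Maps (f x y : PermModel.{u, v} G) : Prop :=
  ∃ p : PermModel.{u, v} G, p ∈ f ∧ p.IsPair x y

/-- `f` is a function from `X` to `Y`. -/
def IsFunction (f X Y : PermModel.{u, v} G) : Prop :=
  f.IsSet ∧ (∀ p ∈ f, ∃ x ∈ X, ∃ y ∈ Y, p.IsPair x y) ∧ ∀ x ∈ X, ∃! y, f.Maps x y

/-- `X` is dually Dedekind finite in the model: every surjection from `X` onto `X` is injective. -/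
def DuallyDedekindFinite (X : PermModel.{u, v} G) : Prop :=
  ∀ f : PermModel.{u, v} G, f.IsFunction X X → (∀ y ∈ X, ∃ x ∈ X, f.Maps x y) →
    ∀ x₁ ∈ X, ∀ x₂ ∈ X, ∀ y, f.Maps x₁ y → f.Maps x₂ y → x₁ = x₂

/-- `x` is the von Neumann numeral `k`. -/
def IsNumeral : ℕ → PermModel.{u, v} G → Prop
  | 0, x => x.IsSet ∧ ∀ y, y ∉ x
  | k + 1, x => ∃ z, IsNumeral k z ∧ x.IsSet ∧ ∀ y, y ∈ x ↔ y ∈ z ∨ y = z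

/-- `P = X ^ k`, the set of all functions from `k = {0, …, k - 1}` to `X`. -/
def IsPower (P X : PermModel.{u, v} G) (k : ℕ) : Prop :=
  P.IsSet ∧ ∀ f, f ∈ P ↔ ∃ d, IsNumeral k d ∧ f.IsFunction d X

/-- `P = ∏_{i < m} Y i`, the set of all functions `f` with domain `m = {0, …, m - 1}`
and `f(i) ∈ Y i` for all `i < m`. -/
def IsProduct {m : ℕ} (P : PermModel.{u, v} G) (Y : Fin m → PermModel.{u, v} G) : Prop :=
  P.IsSet ∧ ∀ f, f ∈ P ↔ f.IsSet ∧
    (∀ p ∈ f, ∃ (i : Fin m) (d : PermModel.{u, v} G), IsNumeral i d ∧ ∃ y ∈ Y i, p.IsPair d y) ∧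
    ∀ (i : Fin m) (d : PermModel.{u, v} G), IsNumeral i d → ∃! y, f.Maps d y

/-- `X` is the set of the atoms `a ∈ S`. -/
def IsSetOfAtoms (X : PermModel.{u, v} G) (S : Set A) : Prop :=
  X.IsSet ∧ ∀ y : PermModel.{u, v} G, y ∈ X ↔ ∃ a ∈ S, y.1 = ZFA.atom a

end PermModel

/-! ## The atoms, the functions `f n` and the group -/

namespace DualDedekind

/-- The atoms: `⟨n, s, _⟩` is the atom `[s]_n`, where `s` is a nonempty finite string
of numbers `0, …, n`. -/
structure Atom : Type where
  n : ℕ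
  str : List (Fin (n + 1))
  str_ne : str ≠ []

/-- The atom `[i ⌢ s]_n`. -/
def at_ (n : ℕ) (i : Fin (n + 1)) (s : List (Fin (n + 1))) : Atom :=
  ⟨n, i :: s, List.cons_ne_nil i s⟩

/-- The set `A_{n,i}` of the atoms `[i ⌢ s]_n`. -/
def block (n : ℕ) (i : Fin (n + 1)) : Set Atom :=
  Set.range (at_ n i)

/-- `x = ([0 j₀]_n, …, [n jₙ]_n)`. -/
def baseTuple {n : ℕ} (j : Fin (n + 1) → Fin (n + 1)) : Fin (n + 1) → Atom :=
  fun i => at_ n i [j i]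

/-- `x = ([0 ⌢ s₀ ⌢ k₀ l₀]_n, …, [n ⌢ sₙ ⌢ kₙ lₙ]_n)`. -/
def stepTuple {n : ℕ} (s : Fin (n + 1) → List (Fin (n + 1))) (k l : Fin (n + 1) → Fin (n + 1)) :
    Fin (n + 1) → Atom :=
  fun i => at_ n i (s i ++ [k i, l i])

/-- `FRel n x y` says `f n x = y` for the function
`f n : ∏_{i ≤ n} A_{n,i} → {∅} ∪ ∏_{i ≤ n} A_{n,i}`, where `none` stands for `∅`.
The sum of the `k j` is taken in `Fin (n + 1)`, that is, modulo `n + 1`. -/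
inductive FRel (n : ℕ) : (Fin (n + 1) → Atom) → Option (Fin (n + 1) → Atom) → Prop
  | base (j : Fin (n + 1) → Fin (n + 1)) : FRel n (baseTuple j) none
  | step (s : Fin (n + 1) → List (Fin (n + 1))) (k l : Fin (n + 1) → Fin (n + 1))
      (hs : ∀ i i', (s i).length = (s i').length) :
      FRel n (stepTuple s k l)
        (some fun i => at_ n i (s i ++ [∑ j ∈ Finset.univ.erase i, k j]))
  | other (x : Fin (n + 1) → Atom) (hx : ∀ i, x i ∈ block n i)
      (hbase : ∀ j, x ≠ baseTuple j)
      (hstep : ∀ s k l, (∀ i i', (s i).length = (s i').length) → x ≠ stepTuple s k l) :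
      FRel n x (some x)

/-- The graph of `f n`, a set of ordered pairs. -/
def fGraph (n : ℕ) : Set ((Fin (n + 1) → Atom) × Option (Fin (n + 1) → Atom)) :=
  {p | FRel n p.1 p.2}

/-- The action of a permutation of the atoms on pairs of a tuple of atoms and a tuple or `∅`. -/
def pairAct {m : ℕ} (π : Equiv.Perm Atom) (p : (Fin m → Atom) × Option (Fin m → Atom)) :
    (Fin m → Atom) × Option (Fin m → Atom) :=
  (fun i => π (p.1 i), p.2.map fun z i => π (z i))

theorem pairAct_one {m : ℕ} : pairAct (m := m) 1 = id := by
  funext p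
  rcases p with ⟨x, _ | y⟩ <;> rfl

theorem pairAct_mul {m : ℕ} (π ρ : Equiv.Perm Atom) :
    pairAct (m := m) (π * ρ) = pairAct π ∘ pairAct ρ := by
  funext p
  rcases p with ⟨x, _ | y⟩ <;> rfl

/-- The group of all permutations `π` of the atoms such that, for every `n`,
`π` fixes every `A_{n,i}` setwise, `π` preserves the length of strings, and `π f_n = f_n`. -/
def group : Subgroup (Equiv.Perm Atom) where
  carrier := {π | ∀ n : ℕ,
    (∀ i : Fin (n + 1), π '' block n i = block n i) ∧
    (∀ (s t : List (Fin (n + 1))) (hs : s ≠ []) (ht : t ≠ []),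
      π ⟨n, s, hs⟩ = ⟨n, t, ht⟩ → s.length = t.length) ∧
    pairAct π '' fGraph n = fGraph n}
  one_mem' n := by
    refine ⟨fun i => ?_, fun s t hs ht h => ?_, ?_⟩
    · simp
    · simp only [Equiv.Perm.coe_one, id_eq, Atom.mk.injEq, heq_eq_eq, true_and] at h
      rw [h]
    · rw [pairAct_one, Set.image_id]
  mul_mem' {π ρ} hπ hρ n := by
    refine ⟨fun i => ?_, fun s t hs ht h => ?_, ?_⟩
    · rw [Equiv.Perm.coe_mul, Set.image_comp, (hρ n).1, (hπ n).1]
    · obtain ⟨i, s', rfl⟩ := List.exists_cons_of_ne_nil hs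
      have hmem : ρ ⟨n, i :: s', hs⟩ ∈ block n i := by
        rw [← (hρ n).1 i]
        exact ⟨_, ⟨s', rfl⟩, rfl⟩
      obtain ⟨r, hr⟩ := hmem
      have h₁ := (hρ n).2.1 _ _ hs (List.cons_ne_nil i r) hr.symm
      rw [Equiv.Perm.mul_apply, ← hr] at h
      exact h₁.trans ((hπ n).2.1 _ _ _ _ h)
    · rw [pairAct_mul, Set.image_comp, (hρ n).2.2, (hπ n).2.2]
  inv_mem' {π} hπ n := by
    refine ⟨fun i => ?_, fun s t hs ht h => ?_, ?_⟩
    · conv_lhs => rw [← (hπ n).1 i]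
      rw [← Set.image_comp, ← Equiv.Perm.coe_mul, inv_mul_cancel, Equiv.Perm.coe_one, Set.image_id]
    · rw [Equiv.Perm.inv_eq_iff_eq] at h
      exact ((hπ n).2.1 _ _ _ _ h.symm).symm
    · conv_lhs => rw [← (hπ n).2.2]
      rw [← Set.image_comp, ← pairAct_mul, inv_mul_cancel, pairAct_one, Set.image_id]

/-- The permutation model `𝒱`. -/
abbrev Model : Type (u + 1) := PermModel.{u, 0} group

/-- In `𝒱`, `P = ∏_{i ≤ n} A_{n,i} ^ (e i)`. -/
def IsProductOfPowers (n : ℕ) (e : Fin (n + 1) → ℕ) (P : Model.{u}) : Prop :=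
  ∃ B D : Fin (n + 1) → Model.{u}, (∀ i, (B i).IsSetOfAtoms (block n i)) ∧
    (∀ i, (D i).IsPower (B i) (e i)) ∧ P.IsProduct D

end DualDedekind

/-! ## A criterion for injectivity of surjections -/

/-! Elements of the product are coded by tuples of strings, one string for each `i` and each `j < e
i`. A surjection in the model then becomes a surjection `F` of tuples that commutes with every
permutation in `group` fixing a finite support `E`.

The permutations used are the twists. At position `p`, a twist shifts the last entry of the strings
of length `p + 1` (leading index not counted) in every block except `i₀`; in block `i₀` it shifts
the entry at `p` of all longer strings. The second shift compensates the first, because `f_n`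
computes a new last entry in block `i` from the sum of the `k j` with `j ≠ i`. Hence twists lie in
`group` (`FRel.twist`, `twist_mem_group`), and they fix `E` once `p` is large
(`exists_twist_fixes`).

If `e i₀ = 0`, the compensation is invisible on tuples: a twist at `p` by `1` fixes a tuple exactly
when no string in it has length `p + 1` (`Tuple.twist_eq_iff`). So beyond some bound `M`, `F`
creates no new lengths. Boundedly many lengths occur in a tuple, and only finitely many tuples share
a given set of lengths above `M`. Backward orbits of `F` are therefore finite, every tuple is
periodic, and `F` is injective (`Function.Surjective.injective_of_rank`). -/

theorem Function.Surjective.injective_of_rank {T α : Type*} [DecidableEq α] {F : T → T}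
    (hF : Function.Surjective F) (lev : T → Finset α) (m : ℕ) (hm : ∀ t, (lev t).card ≤ m)
    (hfin : ∀ S, {t | lev t = S}.Finite) (hmono : ∀ t, lev (F t) ⊆ lev t) :
    Function.Injective F := by
  have key : ∀ t, t ∈ Function.periodicPts F := by
    intro t
    obtain ⟨G, hG⟩ := hF.hasRightInverse
    -- Along a backward orbit the sets `lev` can only grow; their bounded size forces them to
    -- stabilise.
    have hmon : Monotone fun k => lev (G^[k] t) := by
      refine monotone_nat_of_le_succ fun k => ?_
      rw [Function.iterate_succ_apply']
      have := hmono (G (G^[k] t))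
      rwa [hG] at this
    have hcard : Monotone fun k =>
        (⟨(lev (G^[k] t)).card, Nat.lt_succ_of_le (hm _)⟩ : Fin (m + 1)) :=
      fun a b h => Finset.card_le_card (hmon h)
    obtain ⟨k₀, hk₀⟩ := WellFoundedGT.monotone_chain_condition ⟨_, hcard⟩
    have hS : ∀ k ≥ k₀, lev (G^[k] t) = lev (G^[k₀] t) := by
      intro k hk
      refine (Finset.eq_of_subset_of_card_le (hmon hk) ?_).symm
      have := congrArg Fin.val (hk₀ k hk)
      exact this.ge
    -- From `k₀` on the backward orbit stays in one finite fibre of `lev`, so it repeats.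
    obtain ⟨a, -, b, -, hne, hab⟩ := (Set.Ici_infinite k₀).exists_ne_map_eq_of_mapsTo
      (f := fun k => G^[k] t) (t := {x | lev x = lev (G^[k₀] t)}) (fun k hk => hS k hk) (hfin _)
    have hcancel : ∀ k x, F^[k] (G^[k] x) = x := fun k x => hG.iterate k x
    have main : ∀ a b, a < b → G^[a] t = G^[b] t → t ∈ Function.periodicPts F := by
      intro a b hlt heq
      refine Function.mk_mem_periodicPts (Nat.sub_pos_of_lt hlt) ?_
      -- Applying `F^[b]` to `G^[a] t = G^[b] t` leaves `F^[b - a] t = t`.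
      have h1 := congrArg F^[b] heq
      rw [hcancel] at h1
      conv_lhs at h1 => rw [← Nat.sub_add_cancel hlt.le, Function.iterate_add_apply, hcancel]
      exact h1
    rcases hne.lt_or_gt with h | h
    · exact main a b h hab
    · exact main b a h hab.symm
  exact fun x y h => (Function.bijOn_periodicPts F).injOn (key x) (key y) h

namespace DualDedekind

/-! ## Permutations in the group -/

/-- The action on the strings `s` of the atoms `[i ⌢ s]_n`: add `c` to the entry at position `p`
if either `i = i₀` and this entry is not the last one, or `i ≠ i₀` and it is the last one. -/
def twistStr {n : ℕ} (i₀ c : Fin (n + 1)) (p : ℕ) (i : Fin (n + 1)) (s : List (Fin (n + 1))) :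
    List (Fin (n + 1)) :=
  if (i = i₀ ∧ p + 1 < s.length) ∨ (i ≠ i₀ ∧ s.length = p + 1) then s.modify p (· + c) else s

@[simp] theorem length_twistStr {n : ℕ} (i₀ c : Fin (n + 1)) (p : ℕ) (i : Fin (n + 1))
    (s : List (Fin (n + 1))) : (twistStr i₀ c p i s).length = s.length := by
  unfold twistStr
  split_ifs <;> simp

theorem modify_add_cancel {n : ℕ} (p : ℕ) {c d : Fin (n + 1)} (h : c + d = 0)
    (s : List (Fin (n + 1))) : (s.modify p (· + c)).modify p (· + d) = s := by
  apply List.ext_getElem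
  · simp
  · intro k h₁ h₂
    simp only [List.getElem_modify]
    split_ifs
    · rw [add_assoc, h, add_zero]
    · rfl

/-- The condition for a shift depends only on the block and the length, which twisting preserves, so
the two twists shift at the same place or not at all. -/
theorem twistStr_cancel {n : ℕ} (i₀ : Fin (n + 1)) {c d : Fin (n + 1)} (h : c + d = 0) (p : ℕ)
    (i : Fin (n + 1)) (s : List (Fin (n + 1))) :
    twistStr i₀ d p i (twistStr i₀ c p i s) = s := by
  rw [twistStr, length_twistStr, twistStr]
  split_ifs
  · exact modify_add_cancel p h s
  · rfl

/-- The map `[i ⌢ s]_n ↦ [i ⌢ s']_n`, where `s'` is given by `twistStr`. -/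
def twistFun (i₀ c : ∀ n : ℕ, Fin (n + 1)) (p : ℕ) : Atom → Atom
  | ⟨_, [], h⟩ => (h rfl).elim
  | ⟨n, i :: s, _⟩ => at_ n i (twistStr (i₀ n) (c n) p i s)

theorem twistFun_at (i₀ c : ∀ n : ℕ, Fin (n + 1)) (p n : ℕ) (i : Fin (n + 1))
    (s : List (Fin (n + 1))) :
    twistFun i₀ c p (at_ n i s) = at_ n i (twistStr (i₀ n) (c n) p i s) := rfl

theorem exists_eq_at (a : Atom) : ∃ n i s, a = at_ n i s := by
  rcases a with ⟨n, _ | ⟨i, s⟩, h⟩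
  · exact (h rfl).elim
  · exact ⟨n, i, s, rfl⟩

theorem twistFun_cancel (i₀ : ∀ n : ℕ, Fin (n + 1)) {c d : ∀ n : ℕ, Fin (n + 1)}
    (h : ∀ n, c n + d n = 0) (p : ℕ) (a : Atom) :
    twistFun i₀ d p (twistFun i₀ c p a) = a := by
  obtain ⟨n, i, s, rfl⟩ := exists_eq_at a
  rw [twistFun_at, twistFun_at, twistStr_cancel _ (h n)]

/-- `twistFun` as a permutation of the atoms. -/
def twist (i₀ c : ∀ n : ℕ, Fin (n + 1)) (p : ℕ) : Equiv.Perm Atom where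
  toFun := twistFun i₀ c p
  invFun := twistFun i₀ (fun n => - c n) p
  left_inv := twistFun_cancel i₀ (fun n => add_neg_cancel (c n)) p
  right_inv := twistFun_cancel i₀ (fun n => neg_add_cancel (c n)) p

@[simp] theorem twist_at (i₀ c : ∀ n : ℕ, Fin (n + 1)) (p n : ℕ) (i : Fin (n + 1))
    (s : List (Fin (n + 1))) :
    twist i₀ c p (at_ n i s) = at_ n i (twistStr (i₀ n) (c n) p i s) := rfl

theorem twist_cancel (i₀ : ∀ n : ℕ, Fin (n + 1)) {c d : ∀ n : ℕ, Fin (n + 1)}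
    (h : ∀ n, c n + d n = 0) (p : ℕ) (a : Atom) : twist i₀ d p (twist i₀ c p a) = a :=
  twistFun_cancel i₀ h p a

/-! ### Compatibility of the twists with `f_n` -/

theorem modify_append_of_lt {α : Type*} (f : α → α) {p : ℕ} {s : List α} (t : List α)
    (h : p < s.length) : (s ++ t).modify p f = s.modify p f ++ t := by
  apply List.ext_getElem
  · simp
  · intro k h₁ h₂
    simp only [List.getElem_modify, List.getElem_append, List.length_modify]
    split_ifs <;> first | rfl | omega

theorem modify_append_add {α : Type*} (f : α → α) (p : ℕ) (s t : List α) :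
    (s ++ t).modify (s.length + p) f = s ++ t.modify p f := by
  apply List.ext_getElem
  · simp
  · intro k h₁ h₂
    simp only [List.getElem_modify, List.getElem_append]
    split_ifs <;> first | rfl | omega

/-- The term at `i₀` occurs in every sum except the one that omits it. This is what makes the shifts
in the other blocks match. -/
theorem sum_erase_twist {n : ℕ} (i₀ c : Fin (n + 1)) (k : Fin (n + 1) → Fin (n + 1))
    (i : Fin (n + 1)) :
    ∑ j ∈ Finset.univ.erase i, (if j = i₀ then k j + c else k j) =
      (∑ j ∈ Finset.univ.erase i, k j) + if i = i₀ then 0 else c := by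
  have : ∀ j, (if j = i₀ then k j + c else k j) = k j + if j = i₀ then c else 0 := by
    intro j
    split_ifs <;> simp
  simp only [this, Finset.sum_add_distrib, Finset.sum_ite_eq', Finset.mem_erase, Finset.mem_univ,
    and_true]
  congr 1
  by_cases h : i = i₀
  · simp [h]
  · simp [h, Ne.symm h]

theorem twistStr_base {n : ℕ} (i₀ c : Fin (n + 1)) (p : ℕ) (i j : Fin (n + 1)) :
    twistStr i₀ c p i [j] = [if i ≠ i₀ ∧ p = 0 then j + c else j] := by
  unfold twistStr
  rcases p with _ | p
  · by_cases h : i = i₀ <;> simp [h]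
  · simp

theorem twistStr_step {n : ℕ} (i₀ c : Fin (n + 1)) (p : ℕ) (i k l : Fin (n + 1))
    (s : List (Fin (n + 1))) :
    twistStr i₀ c p i (s ++ [k, l]) =
      (if i = i₀ ∧ p < s.length then s.modify p (· + c) else s) ++
        [if p = s.length then (if i = i₀ then k + c else k) else k,
          if i ≠ i₀ ∧ p = s.length + 1 then l + c else l] := by
  unfold twistStr
  by_cases h : i = i₀
  · rcases lt_trichotomy p s.length with hp | rfl | hp
    · have : p ≠ s.length := hp.ne
      simp [h, hp, this, modify_append_of_lt, show p < s.length + 1 by omega]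
    · have := modify_append_add (· + c) 0 s [k, l]
      simp at this
      simp [h, this]
    · simp [h, show ¬ p < s.length by omega, show p ≠ s.length by omega,
        show ¬ p < s.length + 1 by omega]
  · by_cases hp : p = s.length + 1
    · subst hp
      have := modify_append_add (· + c) 1 s [k, l]
      simp at this
      simp [h, this]
    · simp [h, hp, show ¬ s.length + 1 = p by omega]

theorem twistStr_value {n : ℕ} (i₀ c : Fin (n + 1)) (p : ℕ) (i m : Fin (n + 1))
    (s : List (Fin (n + 1))) :
    twistStr i₀ c p i (s ++ [m]) =
      (if i = i₀ ∧ p < s.length then s.modify p (· + c) else s) ++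
        [if p = s.length then m + (if i = i₀ then 0 else c) else m] := by
  unfold twistStr
  by_cases h : i = i₀
  · by_cases hp : p < s.length
    · simp [h, hp, hp.ne, modify_append_of_lt]
    · simp [h, hp]
  · by_cases hp : p = s.length
    · subst hp
      have := modify_append_add (· + c) 0 s [m]
      simp at this
      simp [h, this]
    · simp [h, hp, show ¬ s.length = p by omega]

theorem exists_twist_baseTuple (i₀ c : ∀ n : ℕ, Fin (n + 1)) (p : ℕ) {n : ℕ}
    (j : Fin (n + 1) → Fin (n + 1)) :
    ∃ j', (fun i => twist i₀ c p (baseTuple j i)) = baseTuple j' :=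
  ⟨fun i => if i ≠ i₀ n ∧ p = 0 then j i + c n else j i, funext fun i => by
    rw [baseTuple, twist_at, twistStr_base]
    rfl⟩

theorem twist_stepTuple (i₀ c : ∀ n : ℕ, Fin (n + 1)) (p : ℕ) {n : ℕ}
    (s : Fin (n + 1) → List (Fin (n + 1))) (k l : Fin (n + 1) → Fin (n + 1)) :
    (fun i => twist i₀ c p (stepTuple s k l i)) = stepTuple
      (fun i => if i = i₀ n ∧ p < (s i).length then (s i).modify p (· + c n) else s i)
      (fun i => if p = (s i).length then (if i = i₀ n then k i + c n else k i) else k i)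
      (fun i => if i ≠ i₀ n ∧ p = (s i).length + 1 then l i + c n else l i) :=
  funext fun i => by rw [stepTuple, twist_at, twistStr_step]; rfl

theorem exists_twist_stepTuple (i₀ c : ∀ n : ℕ, Fin (n + 1)) (p : ℕ) {n : ℕ}
    (s : Fin (n + 1) → List (Fin (n + 1))) (k l : Fin (n + 1) → Fin (n + 1))
    (hs : ∀ i i', (s i).length = (s i').length) :
    ∃ s' k' l', (∀ i i', (s' i).length = (s' i').length) ∧
      (fun i => twist i₀ c p (stepTuple s k l i)) = stepTuple s' k' l' := by
  refine ⟨_, _, _, fun i i' => ?_, twist_stepTuple i₀ c p s k l⟩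
  have : ∀ i, (if i = i₀ n ∧ p < (s i).length then (s i).modify p (· + c n) else s i).length =
      (s i).length := fun i => by split_ifs <;> simp
  rw [this, this, hs]

/-- For a step with prefixes of length `L`: if `p < L`, only the prefix in block `i₀` changes, and
it is copied; if `p = L`, shifting `k i₀` shifts the computed last entry in exactly the blocks `i ≠
i₀`; if `p = L + 1`, only the discarded entries `l i` change. For larger `p` nothing moves. -/
theorem FRel.twist (i₀ c : ∀ n : ℕ, Fin (n + 1)) (p : ℕ) {n : ℕ} {x : Fin (n + 1) → Atom}
    {y : Option (Fin (n + 1) → Atom)} (h : FRel n x y) :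
    FRel n (fun i => twist i₀ c p (x i)) (y.map fun z i => DualDedekind.twist i₀ c p (z i)) := by
  have inv : ∀ a, DualDedekind.twist i₀ (fun n => - c n) p (DualDedekind.twist i₀ c p a) = a :=
    twist_cancel i₀ (fun n => add_neg_cancel (c n)) p
  cases h with
  | base j =>
    obtain ⟨j', hj'⟩ := exists_twist_baseTuple i₀ c p j
    rw [hj']
    exact .base j'
  | step s k l hs =>
    rw [twist_stepTuple]
    have hlen : ∀ i, (if i = i₀ n ∧ p < (s i).length then (s i).modify p (· + c n)
        else s i).length = (s i).length := fun i => by split_ifs <;> simp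
    convert FRel.step _ _ _ _ using 1
    · simp only [Option.map_some]
      congr 1
      funext i
      rw [twist_at, twistStr_value]
      congr 3
      -- All prefixes have the same length, so this condition is the same for every `j` in the sum.
      by_cases hp : p = (s i).length
      · rw [if_pos hp, ← sum_erase_twist]
        refine Finset.sum_congr rfl fun j _ => ?_
        rw [if_pos (hp.trans (hs i j))]
      · rw [if_neg hp]
        refine Finset.sum_congr rfl fun j _ => ?_
        rw [if_neg fun h => hp (h.trans (hs j i))]
    · intro i i'
      rw [hlen, hlen, hs]
  -- The inverse twist would carry a base or step tuple back to one of the same kind, so the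
  -- remaining tuples stay remaining.
  | other x hx hbase hstep =>
    refine .other _ (fun i => ?_) (fun j hj => ?_) fun s k l hs h => ?_
    · obtain ⟨s, hs⟩ := hx i
      rw [← hs]
      exact ⟨_, rfl⟩
    · obtain ⟨j', hj'⟩ := exists_twist_baseTuple i₀ (fun n => - c n) p j
      refine hbase j' ?_
      rw [← hj', ← hj]
      simp only [inv]
    · obtain ⟨s', k', l', hs', h'⟩ := exists_twist_stepTuple i₀ (fun n => - c n) p s k l hs
      refine hstep s' k' l' hs' ?_
      rw [← h', ← h]
      simp only [inv]

theorem image_eq_of_mapsTo {α : Type*} {f g : α → α} {S : Set α} (hf : ∀ x ∈ S, f x ∈ S)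
    (hg : ∀ x ∈ S, g x ∈ S) (hfg : ∀ x, f (g x) = x) : f '' S = S :=
  Set.Subset.antisymm (Set.image_subset_iff.2 hf) fun x hx => ⟨g x, hg x hx, hfg x⟩

theorem twist_mem_group (i₀ c : ∀ n : ℕ, Fin (n + 1)) (p : ℕ) : twist i₀ c p ∈ group := by
  have inv : ∀ a, twist i₀ c p (twist i₀ (fun n => - c n) p a) = a :=
    twist_cancel i₀ (fun n => neg_add_cancel (c n)) p
  intro n
  refine ⟨fun i => ?_, fun s t hs ht h => ?_, ?_⟩
  · refine image_eq_of_mapsTo (g := twist i₀ (fun n => - c n) p) ?_ ?_ inv <;>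
    · rintro _ ⟨s, rfl⟩
      exact ⟨_, rfl⟩
  · obtain ⟨i, s', rfl⟩ := List.exists_cons_of_ne_nil hs
    change at_ n i (twistStr (i₀ n) (c n) p i s') = _ at h
    simp only [at_, Atom.mk.injEq, heq_eq_eq, true_and] at h
    rw [← h]
    simp
  · refine image_eq_of_mapsTo (g := pairAct (twist i₀ (fun n => - c n) p)) ?_ ?_ fun x => ?_
    · exact fun x hx => FRel.twist i₀ c p hx
    · exact fun x hx => FRel.twist i₀ _ p hx
    · rcases x with ⟨x, _ | y⟩ <;> simp [pairAct, inv]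

theorem exists_twist_fixes (E : Finset Atom) :
    ∃ M, ∀ (i₀ c : ∀ n : ℕ, Fin (n + 1)) (p : ℕ), M ≤ p → ∀ a ∈ E, twist i₀ c p a = a := by
  -- `a.str` includes the leading block index, so the twisted part of each atom in `E` is shorter
  -- than `p`.
  refine ⟨E.sup fun a => a.str.length, fun i₀ c p hp a ha => ?_⟩
  have hle := (Finset.le_sup (f := fun a : Atom => a.str.length) ha).trans hp
  obtain ⟨n, i, s, rfl⟩ := exists_eq_at a
  simp only [at_, List.length_cons] at hle
  rw [twist_at, twistStr, if_neg]
  rintro (h | h) <;> omega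

/-! ## Tuples of strings -/

/-- The families of strings which represent the elements of `∏_{i ≤ n} A_{n,i} ^ (e i)`. -/
abbrev Tuple (n : ℕ) (e : Fin (n + 1) → ℕ) : Type :=
  ∀ i : Fin (n + 1), Fin (e i) → List (Fin (n + 1))

/-- The action of `twist` on tuples. -/
def Tuple.twist {n : ℕ} {e : Fin (n + 1) → ℕ} (i₀ c : Fin (n + 1)) (p : ℕ) (t : Tuple n e) :
    Tuple n e :=
  fun i j => twistStr i₀ c p i (t i j)

/-- The set of the lengths of the strings in a tuple. -/
def Tuple.lengths {n : ℕ} {e : Fin (n + 1) → ℕ} (t : Tuple n e) : Finset ℕ :=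
  Finset.univ.image fun x : (i : Fin (n + 1)) × Fin (e i) => (t x.1 x.2).length

theorem Tuple.mem_lengths {n : ℕ} {e : Fin (n + 1) → ℕ} {t : Tuple n e} {r : ℕ} :
    r ∈ t.lengths ↔ ∃ i j, (t i j).length = r := by
  simp [Tuple.lengths]

theorem Tuple.card_lengths_le {n : ℕ} {e : Fin (n + 1) → ℕ} (t : Tuple n e) :
    t.lengths.card ≤ Fintype.card ((i : Fin (n + 1)) × Fin (e i)) :=
  Finset.card_image_le

theorem Tuple.finite_of_length_le {n : ℕ} (e : Fin (n + 1) → ℕ) (K : ℕ) :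
    {t : Tuple n e | ∀ i j, (t i j).length ≤ K}.Finite := by
  have := Set.Finite.pi' (ι := Fin (n + 1)) (t := fun i => {v : Fin (e i) → List (Fin (n + 1)) |
    ∀ j, v j ∈ {s : List (Fin (n + 1)) | s.length ≤ K}}) fun i =>
      Set.Finite.pi' fun _ => List.finite_length_le _ K
  exact this

/-- As `e i₀ = 0`, no string of a tuple lies in block `i₀`, so only the rule for last entries can
act. -/
theorem Tuple.twist_eq_iff {n : ℕ} {e : Fin (n + 1) → ℕ} {i₀ : Fin (n + 1)} (h₀ : e i₀ = 0)
    (p : ℕ) (t : Tuple n e) : t.twist i₀ 1 p = t ↔ p + 1 ∉ t.lengths := by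
  have hne : ∀ i, Fin (e i) → i ≠ i₀ := by
    rintro i j rfl
    rw [h₀] at j
    exact j.elim0
  constructor
  · intro h hmem
    obtain ⟨i, j, hij⟩ := Tuple.mem_lengths.1 hmem
    have h1 := congrFun (congrFun h i) j
    have hi := hne i j
    rw [Tuple.twist, twistStr, if_pos (Or.inr ⟨hi, hij⟩)] at h1
    have hp : p < (t i j).length := by omega
    have h2 := List.getElem_of_eq h1 (i := p) (by simpa using hp)
    rw [List.getElem_modify, if_pos rfl, add_eq_left] at h2
    rcases n with _ | n
    -- In `Fin 1` adding `1` changes nothing, but then no block other than `i₀` exists.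
    · exact hi (Fin.ext (by omega))
    · exact one_ne_zero h2
  · intro h
    funext i j
    rw [Tuple.twist, twistStr, if_neg]
    rintro (h' | h')
    · exact hne i j h'.1
    · exact h (Tuple.mem_lengths.2 ⟨i, j, h'.2⟩)

/-- A twist fixing `t` also fixes `F t`, so each length above `M` in `F t` already occurs in `t`.
Lengths up to `M` are not controlled, but they contribute only finitely many strings. -/
theorem Tuple.injective_of_surjective {n : ℕ} {e : Fin (n + 1) → ℕ} {i₀ : Fin (n + 1)}
    (h₀ : e i₀ = 0) {F : Tuple n e → Tuple n e} (hF : Function.Surjective F) (M : ℕ)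
    (hM : ∀ p, M ≤ p → ∀ t, F (t.twist i₀ 1 p) = (F t).twist i₀ 1 p) : Function.Injective F := by
  refine hF.injective_of_rank (fun t => t.lengths.filter (M < ·))
    (Fintype.card ((i : Fin (n + 1)) × Fin (e i)))
    (fun t => (Finset.card_filter_le _ _).trans t.card_lengths_le) (fun S => ?_) fun t r hr => ?_
  · refine (Tuple.finite_of_length_le e (max M (S.sup id))).subset fun t ht i j => ?_
    by_cases h : M < (t i j).length
    · refine le_max_of_le_right (Finset.le_sup (f := id) ?_)
      rw [← ht]
      exact Finset.mem_filter.2 ⟨Tuple.mem_lengths.2 ⟨i, j, rfl⟩, h⟩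
    · exact le_max_of_le_left (not_lt.1 h)
  · rw [Finset.mem_filter] at hr ⊢
    refine ⟨?_, hr.2⟩
    by_contra hnot
    obtain ⟨p, rfl⟩ : ∃ p, r = p + 1 := ⟨r - 1, by omega⟩
    have := hM p (Nat.lt_succ_iff.1 hr.2) t
    rw [(Tuple.twist_eq_iff h₀ p t).2 hnot] at this
    exact (Tuple.twist_eq_iff h₀ p _).1 this.symm hr.1

end DualDedekind

/-! ## Sets in the universe over a type of atoms -/

namespace PreZFA

theorem Equiv.of_mem_iff {A : Type v} {x y : PreZFA.{u, v} A} (hx : ¬ IsAtom x) (hy : ¬ IsAtom y)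
    (h : ∀ z, Mem z x ↔ Mem z y) : Equiv x y := by
  rcases x with a | ⟨ι, f⟩
  · exact (hx trivial).elim
  rcases y with a | ⟨κ, g⟩
  · exact (hy trivial).elim
  rw [Equiv]
  refine ⟨fun i => (h (f i)).1 ⟨i, Equiv.refl _⟩, fun j => ?_⟩
  obtain ⟨i, hi⟩ := (h (g j)).2 ⟨j, Equiv.refl _⟩
  exact ⟨i, hi.symm⟩

/-- If `x` had itself as an element, one of its members would too, against the induction hypothesis.
This serves to distinguish the numerals. -/
theorem not_mem_self {A : Type v} (x : PreZFA.{u, v} A) : ¬ Mem x x := by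
  induction x with
  | atom a => exact id
  | mk ι f ih =>
    rintro ⟨j, hj⟩
    exact ih j (Mem.congr hj hj ⟨j, hj⟩)

theorem mem_perm {A : Type v} (π : Equiv.Perm A) {x y : PreZFA.{u, v} A} (h : Mem x y) :
    Mem (perm π x) (perm π y) := by
  rcases y with a | ⟨ι, f⟩
  · exact h.elim
  · exact h.imp fun _ hi => perm_congr π hi

theorem perm_one {A : Type v} (x : PreZFA.{u, v} A) : perm 1 x = x := by
  induction x with
  | atom a => rfl
  | mk ι f ih => rw [perm, funext ih]

theorem perm_perm {A : Type v} (π ρ : Equiv.Perm A) (x : PreZFA.{u, v} A) :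
    perm π (perm ρ x) = perm (π * ρ) x := by
  induction x with
  | atom a => rfl
  | mk ι f ih => rw [perm, perm, perm, funext ih]

end PreZFA

namespace ZFA

variable {A : Type v}

theorem ext {x y : ZFA.{u, v} A} (hx : ¬ x.IsAtom) (hy : ¬ y.IsAtom) (h : ∀ z, z ∈ x ↔ z ∈ y) :
    x = y := by
  induction x using Quotient.inductionOn with | _ x
  induction y using Quotient.inductionOn with | _ y
  exact Quotient.sound (PreZFA.Equiv.of_mem_iff hx hy fun z => h (Quotient.mk _ z))

theorem not_mem_self (x : ZFA.{u, v} A) : x ∉ x := by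
  induction x using Quotient.inductionOn with | _ x
  exact PreZFA.not_mem_self x

theorem mem_perm (π : Equiv.Perm A) {x y : ZFA.{u, v} A} (h : x ∈ y) : perm π x ∈ perm π y := by
  induction x using Quotient.inductionOn with | _ x
  induction y using Quotient.inductionOn with | _ y
  exact PreZFA.mem_perm π h

theorem perm_one (x : ZFA.{u, v} A) : perm 1 x = x := by
  induction x using Quotient.inductionOn with | _ x
  exact congrArg (Quotient.mk _) (PreZFA.perm_one x)

theorem perm_perm (π ρ : Equiv.Perm A) (x : ZFA.{u, v} A) :
    perm π (perm ρ x) = perm (π * ρ) x := by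
  induction x using Quotient.inductionOn with | _ x
  exact congrArg (Quotient.mk _) (PreZFA.perm_perm π ρ x)

theorem perm_atom (π : Equiv.Perm A) (a : A) : perm π (atom.{u, v} a) = atom (π a) := rfl

theorem atom_injective : Function.Injective (atom.{u, v} : A → ZFA A) := by
  intro a b h
  have h' : PreZFA.Equiv (PreZFA.atom a) (PreZFA.atom b) := Quotient.exact h
  rwa [PreZFA.Equiv] at h'

theorem not_mem_atom (a : A) (x : ZFA.{u, v} A) : x ∉ atom a := by
  induction x using Quotient.inductionOn with | _ x
  exact id

/-- The set of the objects `f i`. -/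
noncomputable def mkSet {ι : Type u} (f : ι → ZFA.{u, v} A) : ZFA.{u, v} A :=
  Quotient.mk _ (PreZFA.mk ι fun i => (f i).out)

@[simp] theorem mem_mkSet {ι : Type u} {f : ι → ZFA.{u, v} A} {x : ZFA.{u, v} A} :
    x ∈ mkSet f ↔ ∃ i, x = f i := by
  induction x using Quotient.inductionOn with | _ x
  refine exists_congr fun i => ⟨fun h => ?_, fun h => ?_⟩
  · exact (Quotient.sound h).trans (Quotient.out_eq (f i))
  · exact Quotient.exact (h.trans (Quotient.out_eq (f i)).symm)

theorem perm_mkSet (π : Equiv.Perm A) {ι : Type u} (f : ι → ZFA.{u, v} A) :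
    perm π (mkSet f) = mkSet fun i => perm π (f i) := by
  refine ext id id fun z => ?_
  constructor
  · intro h
    have h' := mem_perm π⁻¹ h
    rw [perm_perm, inv_mul_cancel, perm_one, mem_mkSet] at h'
    obtain ⟨i, hi⟩ := h'
    refine mem_mkSet.2 ⟨i, ?_⟩
    rw [← hi, perm_perm, mul_inv_cancel, perm_one]
  · intro h
    obtain ⟨i, rfl⟩ := mem_mkSet.1 h
    exact mem_perm π (mem_mkSet.2 ⟨i, rfl⟩)

/-- The unordered pair `{x, y}`. -/
noncomputable def upair (x y : ZFA.{u, v} A) : ZFA.{u, v} A :=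
  mkSet fun b : ULift.{u} Bool => if b.down then x else y

@[simp] theorem mem_upair {x y z : ZFA.{u, v} A} : z ∈ upair x y ↔ z = x ∨ z = y := by
  simp [upair, or_comm]

theorem upair_inj {x y x' y' : ZFA.{u, v} A} :
    upair x y = upair x' y' ↔ x = x' ∧ y = y' ∨ x = y' ∧ y = x' := by
  constructor
  · intro h
    have key := fun z => (mem_upair (x := x) (y := y) (z := z)).symm.trans
      ((iff_of_eq (congrArg (z ∈ ·) h)).trans mem_upair)
    have h1 := (key x).1 (Or.inl rfl)
    have h2 := (key y).1 (Or.inr rfl)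
    have h3 := (key x').2 (Or.inl rfl)
    have h4 := (key y').2 (Or.inr rfl)
    grind
  · rintro (⟨rfl, rfl⟩ | ⟨rfl, rfl⟩)
    · rfl
    · exact ext id id fun z => by simp [or_comm]

/-- The ordered pair `(x, y) = {{x}, {x, y}}`. -/
noncomputable def pair (x y : ZFA.{u, v} A) : ZFA.{u, v} A :=
  upair (upair x x) (upair x y)

theorem pair_inj {x y x' y' : ZFA.{u, v} A} : pair x y = pair x' y' ↔ x = x' ∧ y = y' := by
  simp only [pair, upair_inj]
  grind

theorem perm_upair (π : Equiv.Perm A) (x y : ZFA.{u, v} A) :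
    perm π (upair x y) = upair (perm π x) (perm π y) := by
  rw [upair, perm_mkSet, upair]
  congr 1
  funext b
  split_ifs <;> rfl

theorem perm_pair (π : Equiv.Perm A) (x y : ZFA.{u, v} A) :
    perm π (pair x y) = pair (perm π x) (perm π y) := by
  simp only [pair, perm_upair]

/-- The von Neumann numeral `k = {0, …, k - 1}`. -/
noncomputable def num : ℕ → ZFA.{u, v} A
  | k => mkSet fun i : ULift.{u} (Fin k) => num i.down
termination_by k => k
decreasing_by exact i.down.isLt

theorem mem_num {k : ℕ} {x : ZFA.{u, v} A} : x ∈ num k ↔ ∃ j < k, x = num j := by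
  rw [num]
  simp [Fin.exists_iff]

theorem not_isAtom_num (k : ℕ) : ¬ (num k : ZFA.{u, v} A).IsAtom := by
  rw [num]
  exact id

theorem mem_num_succ {k : ℕ} {x : ZFA.{u, v} A} : x ∈ num (k + 1) ↔ x ∈ num k ∨ x = num k := by
  simp only [mem_num, Nat.lt_succ_iff_lt_or_eq, or_and_right, exists_or, exists_eq_left]

theorem num_injective : Function.Injective (num : ℕ → ZFA.{u, v} A) := by
  intro j k h
  by_contra hne
  rcases Nat.lt_or_gt_of_ne hne with hlt | hlt
  · exact not_mem_self (num k : ZFA.{u, v} A) (mem_num.2 ⟨j, hlt, h.symm⟩)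
  · exact not_mem_self (num j : ZFA.{u, v} A) (mem_num.2 ⟨k, hlt, h⟩)

theorem perm_num (π : Equiv.Perm A) (k : ℕ) : perm π (num k : ZFA.{u, v} A) = num k := by
  induction k using Nat.strong_induction_on with
  | _ k ih =>
    rw [num, perm_mkSet]
    congr 1
    funext i
    exact ih _ i.down.isLt

/-- The function `{(i, v i) ∣ i < m}` with domain `m = {0, …, m - 1}`. -/
noncomputable def graph {m : ℕ} (w : Fin m → ZFA.{u, v} A) : ZFA.{u, v} A :=
  mkSet fun i : ULift.{u} (Fin m) => pair (num i.down) (w i.down)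

@[simp] theorem mem_graph {m : ℕ} {w : Fin m → ZFA.{u, v} A} {p : ZFA.{u, v} A} :
    p ∈ graph w ↔ ∃ i : Fin m, p = pair (num i) (w i) := by
  simp [graph]

theorem num_pair_mem_graph {m : ℕ} {w : Fin m → ZFA.{u, v} A} {i : Fin m} {y : ZFA.{u, v} A} :
    pair (num i) y ∈ graph w ↔ y = w i := by
  rw [mem_graph]
  constructor
  · rintro ⟨j, hj⟩
    rw [pair_inj] at hj
    rw [hj.2, Fin.ext (num_injective hj.1)]
  · rintro rfl
    exact ⟨i, rfl⟩

theorem graph_injective {m : ℕ} : Function.Injective (graph : (Fin m → ZFA.{u, v} A) → _) := by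
  intro w w' h
  funext i
  exact num_pair_mem_graph.1 (h ▸ num_pair_mem_graph.2 rfl)

theorem perm_graph (π : Equiv.Perm A) {m : ℕ} (w : Fin m → ZFA.{u, v} A) :
    perm π (graph w) = graph fun i => perm π (w i) := by
  simp only [graph, perm_mkSet, perm_pair, perm_num]

/-! ## Membership in permutation models -/

variable {G : Subgroup (Equiv.Perm A)}

theorem InModel.mem {x y : ZFA.{u, v} A} (hx : InModel G x) (hy : y ∈ x) : InModel G y := by
  cases hx with
  | intro _ h _ => exact h y hy

theorem InModel.exists_supports {x : ZFA.{u, v} A} (hx : InModel G x) : ∃ E, Supports G E x := by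
  cases hx with
  | intro _ _ h => exact h

theorem inModel_atom (a : A) : InModel G (atom.{u, v} a) :=
  .intro _ (fun y hy => (not_mem_atom a y hy).elim)
    ⟨{a}, fun π _ h => by rw [perm_atom, h a (Finset.mem_singleton_self a)]⟩

theorem inModel_mkSet_of_finite {ι : Type u} [Finite ι] {f : ι → ZFA.{u, v} A}
    (hf : ∀ i, InModel G (f i)) : InModel G (mkSet f) := by
  classical
  have := Fintype.ofFinite ι
  choose E hE using fun i => (hf i).exists_supports
  refine .intro _ (fun y hy => ?_) ⟨Finset.univ.biUnion E, fun π hπ h => ?_⟩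
  · obtain ⟨i, rfl⟩ := mem_mkSet.1 hy
    exact hf i
  · rw [perm_mkSet]
    congr 1
    funext i
    exact hE i π hπ fun a ha => h a (Finset.mem_biUnion.2 ⟨i, Finset.mem_univ i, ha⟩)

/-- Invariance under the whole group gives empty support; the reverse inclusion comes from applying
the hypothesis to `π⁻¹`. -/
theorem inModel_mkSet_of_invariant {ι : Type u} {f : ι → ZFA.{u, v} A}
    (hf : ∀ i, InModel G (f i)) (h : ∀ π ∈ G, ∀ i, ∃ j, perm π (f i) = f j) :
    InModel G (mkSet f) := by
  refine .intro _ (fun y hy => ?_) ⟨∅, fun π hπ _ => ?_⟩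
  · obtain ⟨i, rfl⟩ := mem_mkSet.1 hy
    exact hf i
  · rw [perm_mkSet]
    refine ext id id fun z => ?_
    rw [mem_mkSet, mem_mkSet]
    constructor
    · rintro ⟨i, rfl⟩
      exact h π hπ i
    · rintro ⟨i, rfl⟩
      obtain ⟨j, hj⟩ := h π⁻¹ (inv_mem hπ) i
      refine ⟨j, ?_⟩
      rw [← hj, perm_perm, mul_inv_cancel, perm_one]

theorem inModel_upair {x y : ZFA.{u, v} A} (hx : InModel G x) (hy : InModel G y) :
    InModel G (upair x y) :=
  inModel_mkSet_of_finite fun b => by split_ifs <;> assumption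

theorem inModel_pair {x y : ZFA.{u, v} A} (hx : InModel G x) (hy : InModel G y) :
    InModel G (pair x y) :=
  inModel_upair (inModel_upair hx hx) (inModel_upair hx hy)

theorem inModel_num (k : ℕ) : InModel G (num k : ZFA.{u, v} A) := by
  induction k using Nat.strong_induction_on with
  | _ k ih =>
    rw [num]
    exact inModel_mkSet_of_finite fun i => ih _ i.down.isLt

theorem inModel_graph {m : ℕ} {w : Fin m → ZFA.{u, v} A} (hw : ∀ i, InModel G (w i)) :
    InModel G (graph w) :=
  inModel_mkSet_of_finite fun i => inModel_pair (inModel_num _) (hw i.down)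

end ZFA

/-! ## Absoluteness of the notions of set theory in permutation models -/

namespace PermModel

open ZFA

variable {A : Type v} {G : Subgroup (Equiv.Perm A)}

/-- An element of the universe as an element of the model. -/
def of (x : ZFA.{u, v} A) (hx : InModel G x) : PermModel.{u, v} G := ⟨x, hx⟩

theorem of_val (x : ZFA.{u, v} A) (hx : InModel G x) : (of x hx).1 = x := rfl

theorem ext_iff {x y : PermModel.{u, v} G} : x = y ↔ x.1 = y.1 := Subtype.ext_iff

/-- The model is transitive, so extensionality may be tested on its own elements; the absoluteness
results rest on this. -/
theorem eq_iff_of_isSet {x : PermModel.{u, v} G} {y : ZFA.{u, v} A} (hx : x.IsSet)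
    (hy : ¬ y.IsAtom) (hmem : ∀ z ∈ y, InModel G z) :
    x.1 = y ↔ ∀ z : PermModel.{u, v} G, z ∈ x ↔ z.1 ∈ y := by
  refine ⟨fun h z => by rw [← h]; rfl, fun h => ZFA.ext hx hy fun z => ⟨fun hz => ?_, fun hz => ?_⟩⟩
  · exact (h ⟨z, x.2.mem hz⟩).1 hz
  · exact (h ⟨z, hmem z hz⟩).2 hz

theorem isSet_of_eq {x : PermModel.{u, v} G} {y : ZFA.{u, v} A} (hy : ¬ y.IsAtom) (h : x.1 = y) :
    x.IsSet := by
  rwa [IsSet, h]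

theorem isUnorderedPair_iff {z x y : PermModel.{u, v} G} :
    z.IsUnorderedPair x y ↔ z.1 = upair x.1 y.1 := by
  have key : ∀ hz : z.IsSet, z.1 = upair x.1 y.1 ↔ ∀ w, w ∈ z ↔ w = x ∨ w = y := fun hz => by
    rw [eq_iff_of_isSet hz id fun w hw => (inModel_upair x.2 y.2).mem hw]
    simp only [mem_upair, PermModel.ext_iff]
  exact ⟨fun h => (key h.1).2 h.2, fun h => have hz := isSet_of_eq id h; ⟨hz, (key hz).1 h⟩⟩

theorem isPair_iff {p x y : PermModel.{u, v} G} : p.IsPair x y ↔ p.1 = pair x.1 y.1 := by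
  simp only [IsPair, isUnorderedPair_iff]
  constructor
  · rintro ⟨a, b, ha, hb, h⟩
    rw [h, ha, hb, pair]
  · intro h
    exact ⟨⟨_, inModel_upair x.2 x.2⟩, ⟨_, inModel_upair x.2 y.2⟩, rfl, rfl, h⟩

theorem maps_iff {f x y : PermModel.{u, v} G} : f.Maps x y ↔ pair x.1 y.1 ∈ f.1 := by
  simp only [Maps, isPair_iff]
  constructor
  · rintro ⟨p, hp, h⟩
    rw [← h]
    exact hp
  · exact fun h => ⟨⟨_, inModel_pair x.2 y.2⟩, h, rfl⟩

theorem isNumeral_iff {k : ℕ} {x : PermModel.{u, v} G} : IsNumeral k x ↔ x.1 = num k := by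
  induction k generalizing x with
  | zero =>
    rw [IsNumeral]
    have key : ∀ hx : x.IsSet, x.1 = num 0 ↔ ∀ y, y ∉ x := fun hx => by
      rw [eq_iff_of_isSet hx (not_isAtom_num 0) fun w hw => (inModel_num _).mem hw]
      simp [mem_num]
    exact ⟨fun h => (key h.1).2 h.2,
      fun h => have hx := isSet_of_eq (not_isAtom_num 0) h; ⟨hx, (key hx).1 h⟩⟩
  | succ k ih =>
    rw [IsNumeral]
    have key : ∀ hx : x.IsSet, x.1 = num (k + 1) ↔ ∀ y : PermModel.{u, v} G,
        y ∈ x ↔ y.1 ∈ (num k : ZFA.{u, v} A) ∨ y.1 = num k := fun hx => by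
      rw [eq_iff_of_isSet hx (not_isAtom_num _) fun w hw => (inModel_num _).mem hw]
      simp only [mem_num_succ]
    constructor
    · rintro ⟨z, hz, hx, h⟩
      rw [ih] at hz
      refine (key hx).2 fun y => ?_
      rw [h, ← hz, PermModel.ext_iff]
      rfl
    · intro h
      have hx := isSet_of_eq (not_isAtom_num _) h
      refine ⟨of (num k) (inModel_num k), ih.2 rfl, hx, fun y => ?_⟩
      rw [(key hx).1 h y, PermModel.ext_iff]
      rfl

theorem isProduct_iff {m : ℕ} {P : PermModel.{u, v} G} {Y : Fin m → PermModel.{u, v} G} :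
    P.IsProduct Y ↔ P.IsSet ∧ ∀ f : PermModel.{u, v} G, f ∈ P ↔
      ∃ w : Fin m → PermModel.{u, v} G, (∀ i, w i ∈ Y i) ∧ f.1 = graph fun i => (w i).1 := by
  refine and_congr_right fun _ => forall_congr' fun f => iff_congr Iff.rfl ?_
  simp only [isNumeral_iff, isPair_iff, maps_iff]
  constructor
  · rintro ⟨hf, hp, hu⟩
    choose w hw huniq using fun i : Fin m => hu i (of (num i) (inModel_num i)) rfl
    simp only [of_val] at hw huniq
    refine ⟨w, fun i => ?_, (eq_iff_of_isSet hf id fun z hz =>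
      (inModel_graph fun i => (w i).2).mem hz).2 fun p => ?_⟩
    -- Injectivity of pairs and numerals identifies the index `j` given by the graph condition with
    -- `i`.
    · obtain ⟨j, d, hd, y, hy, h⟩ := hp ⟨_, f.2.mem (hw i)⟩ (hw i)
      rw [hd, pair_inj] at h
      obtain rfl := Fin.ext (num_injective h.1)
      rwa [← Subtype.ext h.2] at hy
    · rw [mem_graph]
      constructor
      · intro hpf
        obtain ⟨i, d, hd, y, hy, h⟩ := hp p hpf
        rw [hd] at h
        refine ⟨i, ?_⟩
        rw [← huniq i y (h ▸ hpf), h]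
      · rintro ⟨i, hi⟩
        have := hw i
        rw [← hi] at this
        exact this
  · rintro ⟨w, hw, h⟩
    refine ⟨isSet_of_eq id h, fun p hp => ?_, fun i d hd => ?_⟩
    · have hp' : p.1 ∈ f.1 := hp
      rw [h, mem_graph] at hp'
      obtain ⟨i, hi⟩ := hp'
      exact ⟨i, (of (num i) (inModel_num i)), rfl, w i, hw i, hi⟩
    · rw [hd, h]
      simp only [num_pair_mem_graph]
      exact ⟨w i, rfl, fun y hy => Subtype.ext hy⟩

theorem isPower_iff {P X : PermModel.{u, v} G} {k : ℕ} :
    P.IsPower X k ↔ P.IsProduct fun _ : Fin k => X := by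
  refine and_congr_right fun _ => forall_congr' fun f => iff_congr Iff.rfl ?_
  have hnum : ∀ {d : PermModel.{u, v} G}, IsNumeral k d → ∀ x : PermModel.{u, v} G,
      x ∈ d ↔ ∃ i : Fin k, IsNumeral i x := fun {d} hd x => by
    rw [isNumeral_iff] at hd
    change x.1 ∈ d.1 ↔ _
    simp only [hd, mem_num, isNumeral_iff, Fin.exists_iff, exists_prop]
  constructor
  · rintro ⟨d, hd, hf, hp, hu⟩
    refine ⟨hf, fun p hpf => ?_, fun i x hx => hu x ((hnum hd x).2 ⟨i, hx⟩)⟩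
    obtain ⟨x, hx, h⟩ := hp p hpf
    obtain ⟨i, hi⟩ := (hnum hd x).1 hx
    exact ⟨i, x, hi, h⟩
  · rintro ⟨hf, hp, hu⟩
    have hd : IsNumeral (G := G) k (of (num k) (inModel_num k)) := isNumeral_iff.2 rfl
    refine ⟨_, hd, hf, fun p hpf => ?_, fun x hx => ?_⟩
    · obtain ⟨i, x, hi, h⟩ := hp p hpf
      exact ⟨x, (hnum hd x).2 ⟨i, hi⟩, h⟩
    · obtain ⟨i, hi⟩ := (hnum hd x).1 hx
      exact hu i x hi

end PermModel

/-! ## The products of powers in the model -/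

namespace DualDedekind

open ZFA PermModel

/-- The element of `∏_{i ≤ n} A_{n,i} ^ (e i)` represented by a tuple of strings. -/
noncomputable def Tuple.code {n : ℕ} {e : Fin (n + 1) → ℕ} (t : Tuple n e) : ZFA.{u, 0} Atom :=
  graph fun i => graph fun j => ZFA.atom (at_ n i (t i j))

theorem at_injective (n : ℕ) (i : Fin (n + 1)) : Function.Injective (at_ n i) := by
  intro s t h
  simpa [at_] using h

theorem Tuple.code_injective {n : ℕ} {e : Fin (n + 1) → ℕ} :
    Function.Injective (Tuple.code.{u} : Tuple n e → _) := by
  intro t t' h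
  funext i j
  have h₁ := congrFun (graph_injective h) i
  exact at_injective n i (atom_injective (congrFun (graph_injective h₁) j))

theorem Tuple.inModel_code {n : ℕ} {e : Fin (n + 1) → ℕ} (t : Tuple n e) :
    InModel group (Tuple.code.{u} t) :=
  inModel_graph fun _ => inModel_graph fun _ => inModel_atom _

theorem Tuple.perm_code {n : ℕ} {e : Fin (n + 1) → ℕ} {π : Equiv.Perm Atom} {t t' : Tuple n e}
    (h : ∀ i j, π (at_ n i (t i j)) = at_ n i (t' i j)) :
    perm π (Tuple.code.{u} t) = Tuple.code t' := by
  simp only [Tuple.code, perm_graph, perm_atom, h]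

theorem exists_apply_at {π : Equiv.Perm Atom} (hπ : π ∈ group) (n : ℕ) (i : Fin (n + 1))
    (s : List (Fin (n + 1))) : ∃ s', π (at_ n i s) = at_ n i s' := by
  have : π (at_ n i s) ∈ π '' block n i := ⟨_, ⟨s, rfl⟩, rfl⟩
  rw [(hπ n).1 i] at this
  exact this.imp fun _ => Eq.symm

/-- The elements of `A_{n,i} ^ k`. -/
noncomputable def powerCode (n : ℕ) (i : Fin (n + 1)) {k : ℕ} (w : Fin k → List (Fin (n + 1))) :
    ZFA.{u, 0} Atom :=
  graph fun j => ZFA.atom (at_ n i (w j))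

theorem isPower_block_iff {n : ℕ} {i : Fin (n + 1)} {B D : Model.{u}} {k : ℕ}
    (hB : B.IsSetOfAtoms (block n i)) :
    D.IsPower B k ↔ D.IsSet ∧ ∀ f : Model.{u}, f ∈ D ↔
      ∃ w : Fin k → List (Fin (n + 1)), f.1 = powerCode n i w := by
  rw [isPower_iff, isProduct_iff]
  refine and_congr_right fun _ => forall_congr' fun f => iff_congr Iff.rfl ?_
  constructor
  · rintro ⟨w, hw, h⟩
    have : ∀ j, ∃ s, (w j).1 = ZFA.atom (at_ n i s) := fun j => by
      obtain ⟨_, ⟨s, rfl⟩, hs⟩ := (hB.2 (w j)).1 (hw j)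
      exact ⟨s, hs⟩
    choose s hs using this
    exact ⟨s, by simp only [h, hs, powerCode]⟩
  · rintro ⟨w, h⟩
    exact ⟨fun j => ⟨_, inModel_atom (at_ n i (w j))⟩,
      fun j => (hB.2 _).2 ⟨_, ⟨w j, rfl⟩, rfl⟩, h⟩

theorem isProduct_powers_iff {n : ℕ} {e : Fin (n + 1) → ℕ} {P : Model.{u}}
    {D : Fin (n + 1) → Model.{u}} (hD : ∀ i (f : Model.{u}), f ∈ D i ↔
      ∃ w : Fin (e i) → List (Fin (n + 1)), f.1 = powerCode n i w) :
    P.IsProduct D ↔ P.IsSet ∧ ∀ f : Model.{u}, f ∈ P ↔ ∃ t : Tuple n e, f.1 = t.code := by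
  rw [isProduct_iff]
  refine and_congr_right fun _ => forall_congr' fun f => iff_congr Iff.rfl ?_
  constructor
  · rintro ⟨w, hw, h⟩
    choose t ht using fun i => (hD i (w i)).1 (hw i)
    exact ⟨t, by simp only [h, ht, powerCode, Tuple.code]⟩
  · rintro ⟨t, h⟩
    exact ⟨fun i => ⟨powerCode n i (t i), inModel_graph fun _ => inModel_atom _⟩,
      fun i => (hD i _).2 ⟨t i, rfl⟩, h⟩

/-- Reduces statements about the product in the model to the concrete type of tuples of strings. -/
theorem IsProductOfPowers.mem_iff {n : ℕ} {e : Fin (n + 1) → ℕ} {P : Model.{u}}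
    (hP : IsProductOfPowers n e P) (f : Model.{u}) : f ∈ P ↔ ∃ t : Tuple n e, f.1 = t.code := by
  obtain ⟨B, D, hB, hD, h⟩ := hP
  exact ((isProduct_powers_iff fun i => ((isPower_block_iff (hB i)).1 (hD i)).2).1 h).2 f

theorem exists_isProductOfPowers (n : ℕ) (e : Fin (n + 1) → ℕ) :
    ∃ P : Model.{u}, IsProductOfPowers n e P := by
  have hB : ∀ i : Fin (n + 1), InModel group (mkSet fun s : ULift.{u} (List (Fin (n + 1))) =>
      ZFA.atom.{u, 0} (at_ n i s.down)) := fun i =>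
    inModel_mkSet_of_invariant (fun _ => inModel_atom _) fun π hπ s => by
      obtain ⟨s', hs'⟩ := exists_apply_at hπ n i s.down
      exact ⟨⟨s'⟩, by rw [perm_atom, hs']⟩
  have hD : ∀ i : Fin (n + 1), InModel group
      (mkSet fun w : ULift.{u} (Fin (e i) → List (Fin (n + 1))) => powerCode.{u} n i w.down) :=
    fun i => inModel_mkSet_of_invariant (fun _ => inModel_graph fun _ => inModel_atom _)
      fun π hπ w => by
        choose w' hw' using fun j => exists_apply_at hπ n i (w.down j)
        exact ⟨⟨w'⟩, by simp only [powerCode, perm_graph, perm_atom, hw']⟩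
  have hP : InModel group (mkSet fun t : ULift.{u} (Tuple n e) => Tuple.code.{u} t.down) :=
    inModel_mkSet_of_invariant (fun t => t.down.inModel_code) fun π hπ t => by
      choose t' ht' using fun i j => exists_apply_at hπ n i (t.down i j)
      exact ⟨⟨t'⟩, Tuple.perm_code ht'⟩
  have hBs : ∀ i, IsSetOfAtoms (of _ (hB i) : Model.{u}) (block n i) := fun i => by
    refine ⟨id, fun y => mem_mkSet.trans ?_⟩
    simp [block]
  have hDm : ∀ i (f : Model.{u}), f ∈ (of _ (hD i) : Model.{u}) ↔
      ∃ w : Fin (e i) → List (Fin (n + 1)), f.1 = powerCode n i w := fun i f =>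
    mem_mkSet.trans ULift.exists
  exact ⟨of _ hP, fun i => of _ (hB i), fun i => of _ (hD i), hBs,
    fun i => (isPower_block_iff (hBs i)).2 ⟨id, hDm i⟩,
    (isProduct_powers_iff hDm).2 ⟨id, fun f => mem_mkSet.trans ULift.exists⟩⟩

theorem duallyDedekindFinite_of_isProductOfPowers {n : ℕ} {e : Fin (n + 1) → ℕ}
    (he : ∃ i, e i = 0) {P : Model.{u}} (hP : IsProductOfPowers n e P) :
    P.DuallyDedekindFinite := by
  obtain ⟨i₀, h₀⟩ := he
  intro f hf hsurj
  have hmem := hP.mem_iff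
  have hcode : ∀ t : Tuple n e, of t.code t.inModel_code ∈ P :=
    fun t => (hmem _).2 ⟨t, rfl⟩
  -- Uniqueness of values ranges over the whole model; that they lie in `P` is read off from the
  -- pairs in `f`.
  have hval : ∀ x y : Model.{u}, f.Maps x y → y ∈ P := by
    rintro x y ⟨p, hp, hxy⟩
    obtain ⟨x', -, y', hy', h⟩ := hf.2.1 p hp
    rw [isPair_iff] at hxy h
    rw [hxy, pair_inj] at h
    rwa [Subtype.ext h.2]
  have hF : ∀ t : Tuple n e, ∃ t' : Tuple n e, pair t.code t'.code ∈ f.1 ∧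
      ∀ y : Model.{u}, f.Maps (of t.code t.inModel_code) y → y.1 = t'.code := fun t => by
    obtain ⟨y, hy, huniq⟩ := hf.2.2 _ (hcode t)
    obtain ⟨t', ht'⟩ := (hmem y).1 (hval _ _ hy)
    refine ⟨t', ?_, fun z hz => ?_⟩
    · rw [← ht']
      exact maps_iff.1 hy
    · rw [huniq z hz, ht']
  choose F hFmem hFuniq using hF
  have huniq : ∀ t t' : Tuple n e, pair t.code t'.code ∈ f.1 → t' = F t := fun t t' h =>
    Tuple.code_injective (hFuniq t (of t'.code t'.inModel_code) (maps_iff.2 h))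
  have hFsurj : Function.Surjective F := fun t => by
    obtain ⟨x, hx, hxt⟩ := hsurj _ (hcode t)
    obtain ⟨t', ht'⟩ := (hmem x).1 hx
    rw [maps_iff, ht'] at hxt
    exact ⟨t', (huniq t' t hxt).symm⟩
  obtain ⟨E, hE⟩ := f.2.exists_supports
  obtain ⟨M, hM⟩ := exists_twist_fixes E
  have hinj : Function.Injective F := by
    refine Tuple.injective_of_surjective h₀ hFsurj M fun p hp t => ?_
    -- A twist acts on all levels at once, so `i₀` is extended to a family; the value `0` at other
    -- levels is arbitrary.
    let j₀ : ∀ m : ℕ, Fin (m + 1) := fun m => if h : n = m then h ▸ i₀ else 0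
    have hj₀ : j₀ n = i₀ := dif_pos rfl
    have htw : ∀ t : Tuple n e, perm (twist j₀ (fun _ => 1) p) (Tuple.code.{u} t) =
        (t.twist i₀ 1 p).code := fun t => Tuple.perm_code fun i j => by
      rw [twist_at, hj₀, Tuple.twist]
    have h := mem_perm (twist j₀ (fun _ => 1) p) (hFmem t)
    -- The twist fixes the support, hence `f`, and so sends the pair for `t` to a pair of `f` with
    -- both tuples twisted.
    rw [hE _ (twist_mem_group _ _ _) (hM _ _ p hp), perm_pair, htw, htw] at h
    exact (huniq _ _ h).symm
  intro x₁ hx₁ x₂ hx₂ y h₁ h₂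
  obtain ⟨t₁, ht₁⟩ := (hmem x₁).1 hx₁
  obtain ⟨t₂, ht₂⟩ := (hmem x₂).1 hx₂
  obtain ⟨t, ht⟩ := (hmem y).1 (hval _ _ h₁)
  rw [maps_iff, ht₁, ht] at h₁
  rw [maps_iff, ht₂, ht] at h₂
  refine Subtype.ext ?_
  rw [ht₁, ht₂, hinj ((huniq _ _ h₁).symm.trans (huniq _ _ h₂))]

end DualDedekind

theorem mainTheorem3 (n : ℕ) (e : Fin (n + 1) → ℕ) (he : ∃ i, e i = 0) :
    (∃ P : DualDedekind.Model.{u}, DualDedekind.IsProductOfPowers n e P) ∧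
      ∀ P : DualDedekind.Model.{u}, DualDedekind.IsProductOfPowers n e P →
        P.DuallyDedekindFinite :=
  ⟨DualDedekind.exists_isProductOfPowers n e,
    fun _ hP => DualDedekind.duallyDedekindFinite_of_isProductOfPowers he hP⟩
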